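/- All spaces are Tychonoff (completely regular and Hausdorff). For a set $Y$ let $\mathcal P(Y)$ be its power set and $[Y]^{\le\omega}$ the family of all countable subsets of $Y$, ordered by inclusion. For a space $X$ let $\exp(X)$ be the family of all nonempty closed subsets of $X$. A partially ordered set $\Gamma$ is $\sigma$-complete if every increasing sequence $s_0\le s_1\le\cdots$ in $\Gamma$ has a supremum. A map $\phi$ from an up-directed $\sigma$-complete partially ordered set $\Gamma$ to $[Y]^{\le\omega}$ is $\omega$-monotone if $\phi(s)\subseteq\phi(t)$ whenever $s\le t$, and $\phi(\sup_n s_n)=\bigcup_n\phi(s_n)$ for every increasing sequence $(s_n)_{n\in\mathbb N}$ in $\Gamma$. A family $\mathcal N\subseteq\exp(X)$ is an external network of $A\subseteq X$ in $X$ if for each $x\in A$ and each open $U\ni x$ there is $N\in\mathcal N$ with $x\in N\subseteq U$. A space is cosmic if it has a countable network, i.e. a countable family $\mathcal N$ of subsets such that for each point $x$ and each open $U\ni x$ there is $N\in\mathcal N$ with $x\in N\subseteq U$. A continuous retraction on $X$ is a continuous map $r:X\to X$ with $r\circ r=r$. * $X$ is monotonically $\omega$-monolithic if there is an $\omega$-monotone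 map $\mathcal N:[X]^{\le\omega}\to[\mathcal P(X)]^{\le\omega}$ such that $\mathcal N(A)$ is an external network of $\mathrm{cl}_X(A)$ in $X$ for each $A\in[X]^{\le\omega}$. * $X$ is monotonically Sokolov if to every $\mathcal F\in[\exp(X)]^{\le\omega}$ one can assign a continuous retraction $r_{\mathcal F}:X\to X$ and a family $\mathcal N(\mathcal F)\in[\mathcal P(X)]^{\le\omega}$ such that $r_{\mathcal F}(F)\subseteq F$ for each $F\in\mathcal F$, $\mathcal N(\mathcal F)$ is an external network of $r_{\mathcal F}(X)$ in $X$, and $\mathcal N$ is $\omega$-monotone. * An $r$-skeleton in $X$ is a family $\{r_s:s\in\Gamma\}$ of continuous retractions on $X$, indexed by a nonempty up-directed $\sigma$-complete partially ordered set $\Gamma$, such that (i) $r_s(X)$ is cosmic for each $s\in\Gamma$; (ii) $r_s=r_s\circ r_t=r_t\circ r_s$ whenever $s\le t$; (iii) if $s_0\le s_1\le\cdots$ in $\Gamma$ and $t=\sup_n s_n$, then $r_t(x)=\lim_{n\to\infty}r_{s_n}(x)$ for each $x\in X$; (iv) $x=\lim_{s\in\Gamma}r_s(x)$ for every $x\in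 X$. * A strong $r$-skeleton in $X$ is an $r$-skeleton $\{r_s:s\in\Gamma\}$ such that for each $s\in\Gamma$, each $n\in\mathbb N$ and each closed $F\subseteq X^n$ there is $t\in\Gamma$ with $s\le t$ and $r_t^n(F)\subseteq F$, where $r_t^n:X^n\to X^n$ is the $n$-th power of the map $r_t$. **Corollary 5.9.** A (Tychonoff) space $X$ is monotonically Sokolov if and only if it is monotonically $\omega$-monolithic and has a strong $r$-skeleton. -/

import Mathlib

open Set Filter Topology

universe u v w

namespace MonotoneTopology

/-- `[Y]^{≤ω}`: the countable (possibly finite or empty) subsets of `Y`, ordered by inclusion. -/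
abbrev CountableSubsets (Y : Type u) : Type u := {A : Set Y // A.Countable}

/-- `exp(X)`: the nonempty closed subsets of `X`. -/
abbrev NonemptyClosedSets (X : Type u) [TopologicalSpace X] : Type u :=
  {F : Set X // F.Nonempty ∧ IsClosed F}

/-- Every increasing sequence has a least upper bound. -/
def IsSigmaComplete (Γ : Type v) [PartialOrder Γ] : Prop :=
  ∀ s : ℕ → Γ, Monotone s → ∃ t, IsLUB (range s) t

/-- `φ : Γ → [Y]^{≤ω}` is `ω`-monotone: it is monotone, and it sends the supremum of an increasing
sequence to the union of the values. -/
structure IsOmegaMonotone {Γ : Type v} [PartialOrder Γ] {Y : Type w}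
    (φ : Γ → CountableSubsets Y) : Prop where
  mono : ∀ s t : Γ, s ≤ t → (φ s : Set Y) ⊆ φ t
  sup : ∀ s : ℕ → Γ, Monotone s → ∀ t : Γ, IsLUB (range s) t →
    (φ t : Set Y) = ⋃ n, (φ (s n) : Set Y)

variable {X : Type u} [TopologicalSpace X]

/-- A family `𝒩` of nonempty closed subsets of `X` is an external network of `A` in `X`. -/
structure IsExternalNetwork (𝒩 : Set (Set X)) (A : Set X) : Prop where
  nonempty : ∀ N ∈ 𝒩, N.Nonempty
  isClosed : ∀ N ∈ 𝒩, IsClosed N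
  exists_mem_subset : ∀ x ∈ A, ∀ U : Set X, IsOpen U → x ∈ U → ∃ N ∈ 𝒩, x ∈ N ∧ N ⊆ U

/-- A continuous retraction of `X` (onto its image): a continuous idempotent self-map. -/
structure IsContinuousRetraction (r : X → X) : Prop where
  continuous : Continuous r
  idempotent : ∀ x, r (r x) = r x

/-- A space is cosmic if it has a countable network. -/
def IsCosmic (Y : Type u) [TopologicalSpace Y] : Prop :=
  ∃ 𝒩 : Set (Set Y), 𝒩.Countable ∧
    ∀ y : Y, ∀ U : Set Y, IsOpen U → y ∈ U → ∃ N ∈ 𝒩, y ∈ N ∧ N ⊆ U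

/-- `X` is monotonically `ω`-monolithic. -/
def IsMonotonicallyOmegaMonolithic (X : Type u) [TopologicalSpace X] : Prop :=
  ∃ 𝒩 : CountableSubsets X → CountableSubsets (Set X),
    IsOmegaMonotone 𝒩 ∧
    ∀ A : CountableSubsets X, IsExternalNetwork (𝒩 A : Set (Set X)) (closure (A : Set X))

/-- `X` is monotonically Sokolov. -/
def IsMonotonicallySokolov (X : Type u) [TopologicalSpace X] : Prop :=
  ∃ (r : CountableSubsets (NonemptyClosedSets X) → X → X)
    (𝒩 : CountableSubsets (NonemptyClosedSets X) → CountableSubsets (Set X)),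
    IsOmegaMonotone 𝒩 ∧
    ∀ ℱ : CountableSubsets (NonemptyClosedSets X),
      IsContinuousRetraction (r ℱ) ∧
      (∀ F ∈ (ℱ : Set (NonemptyClosedSets X)), r ℱ '' (F : Set X) ⊆ F) ∧
      IsExternalNetwork (𝒩 ℱ : Set (Set X)) (range (r ℱ))

/-- `{r_s : s ∈ Γ}` is an `r`-skeleton in `X`. The index set of the family is a nonempty up-directed
`σ`-complete partially ordered set. -/
structure IsRSkeleton {Γ : Type v} [PartialOrder Γ] (r : Γ → X → X) : Prop where
  nonempty : Nonempty Γ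
  directed : ∀ s t : Γ, ∃ u : Γ, s ≤ u ∧ t ≤ u
  sigmaComplete : IsSigmaComplete Γ
  retraction : ∀ s, IsContinuousRetraction (r s)
  cosmic : ∀ s, IsCosmic (range (r s))
  comp_left : ∀ s t, s ≤ t → r s = r s ∘ r t
  comp_right : ∀ s t, s ≤ t → r s = r t ∘ r s
  tendsto_sup : ∀ s : ℕ → Γ, Monotone s → ∀ t : Γ, IsLUB (range s) t →
    ∀ x, Tendsto (fun n => r (s n) x) atTop (𝓝 (r t x))
  tendsto_id : ∀ x, Tendsto (fun s => r s x) atTop (𝓝 x)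

/-- A strong `r`-skeleton: for all `s`, `n` and closed `F ⊆ X^n` there is `t ≥ s` such that the
`n`-th power of `r_t` maps `F` into itself. -/
structure IsStrongRSkeleton {Γ : Type v} [PartialOrder Γ] (r : Γ → X → X) : Prop
    extends IsRSkeleton r where
  strong : ∀ (s : Γ) (n : ℕ) (F : Set (Fin n → X)), IsClosed F →
    ∃ t : Γ, s ≤ t ∧ (fun (x : Fin n → X) (i : Fin n) => r t (x i)) '' F ⊆ F

/-- `X` has a strong `r`-skeleton. -/
def HasStrongRSkeleton (X : Type u) [TopologicalSpace X] : Prop :=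
  ∃ (Γ : Type u) (_ : PartialOrder Γ) (r : Γ → X → X), IsStrongRSkeleton r

end MonotoneTopology

/-!
Countable families are controlled by their finite subfamilies: an `ω`-monotone map `φ` satisfies
`φ ℱ = ⋃ {φ E | E ⊆ ℱ finite}`, and every countable family is contained in a countable family
closed under a prescribed countable-valued operation on finite sets.

*From a strong `r`-skeleton to the monotone Sokolov property.* By `exists_monotone_of_cofinal`
there is a monotone assignment `E ↦ s E` from finite families of closed sets to the index set, such
that the retraction with index `s E` maps every member of `E` into itself. For a countable `ℱ`
exhausted by finite sets `E₀ ⊆ E₁ ⊆ ⋯`, the retraction with index `sup s Eₙ` is the pointwise limit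
of those with indices `s Eₙ`, so it preserves every member of `ℱ`, and its image lies in the closure
of `A ℱ = ⋃ {D E | E ⊆ ℱ finite}`, where `D E` is a countable dense subset of the image of the
retraction with index `s E`. The networks are obtained by composing `A` with the
monotone `ω`-monolithicity operator.

*From the monotone Sokolov property to a strong `r`-skeleton.* Let `r ℱ` and `𝒩 ℱ` be as in the
definition. The index set consists of the saturated families: those countable `𝒢` which, for
each finite `E ⊆ 𝒢`, contain `𝒩 E` and the nonempty sets `(r E) ⁻¹' N` with `N ∈ 𝒩 E`. A saturated
`𝒢` contains `𝒩 𝒢`, so that `r 𝒢'` is the identity on `range (r 𝒢)` for saturated `𝒢' ⊇ 𝒢`, and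
`r E ∘ r 𝒢 = r E` for finite `E ⊆ 𝒢`. As the maps `r E`, `E ⊆ 𝒢` finite, separate the points of
`range (r 𝒢)`, this forces `r 𝒢 ∘ r 𝒢' = r 𝒢`. Convergence along increasing sequences holds because
each `N ∈ 𝒩 (⋃ₙ 𝒢ₙ)` belongs to some `𝒢ₘ`, and is therefore preserved by `r 𝒢ₙ` for `n ≥ m`.
For the preservation of a closed `H ⊆ Xⁿ`, enlarge `𝒢` so that whenever a box `N₁ × ⋯ × Nₙ` of
members of `𝒢` has an open box neighbourhood `U₁ × ⋯ × Uₙ` missing `H`, the complements of the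
sides of one such neighbourhood belong to `𝒢`. If the image of `x` lies in `N₁ × ⋯ × Nₙ`, then `x`
lies in `U₁ × ⋯ × Uₙ`, since the complements of the `Uᵢ` are preserved; hence `x ∉ H`.
-/

namespace MonotoneTopology

/-! ### Countable families and their finite subfamilies -/

section Countable

variable {Γ : Type*} [PartialOrder Γ] {Y : Type v} {Z : Type w}

/-- A finite set as a member of `[Y]^{≤ω}`. -/
def finsetToCountable (E : Finset Y) : CountableSubsets Y :=
  ⟨E, E.countable_toSet⟩

theorem isLUB_of_eq_iUnion {A : ℕ → CountableSubsets Y} {B : CountableSubsets Y}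
    (h : (B : Set Y) = ⋃ n, (A n : Set Y)) : IsLUB (range A) B := by
  constructor
  · rintro _ ⟨n, rfl⟩
    change (A n : Set Y) ⊆ B
    rw [h]
    exact subset_iUnion (fun n => (A n : Set Y)) n
  · intro C hC
    change (B : Set Y) ⊆ C
    rw [h]
    exact iUnion_subset fun n => hC ⟨n, rfl⟩

theorem eq_iUnion_of_isLUB {A : ℕ → CountableSubsets Y} {B : CountableSubsets Y}
    (h : IsLUB (range A) B) : (B : Set Y) = ⋃ n, (A n : Set Y) := by
  have h' : IsLUB (range A) (⟨⋃ n, (A n : Set Y), countable_iUnion fun n => (A n).2⟩ :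
    CountableSubsets Y) := isLUB_of_eq_iUnion rfl
  rw [h.unique h']

theorem exists_monotone_finset_iUnion_eq (A : CountableSubsets Y) :
    ∃ E : ℕ → Finset Y, Monotone E ∧ (A : Set Y) = ⋃ n, (E n : Set Y) := by
  obtain ⟨f, hf⟩ := countable_iff_exists_injOn.1 A.2
  have hfin : ∀ n : ℕ, {y ∈ (A : Set Y) | f y ≤ n}.Finite := fun n =>
    Set.Finite.of_injOn (f := f) (t := Iic n) (fun y hy => hy.2)
      (hf.mono fun y hy => hy.1) (finite_Iic n)
  refine ⟨fun n => (hfin n).toFinset, fun m n hmn y hy => ?_, ?_⟩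
  · simp only [Finite.mem_toFinset, mem_ofPred_eq] at hy ⊢
    exact ⟨hy.1, hy.2.trans hmn⟩
  · ext y
    simp only [Finite.coe_toFinset, mem_iUnion, mem_ofPred_eq]
    exact ⟨fun hy => ⟨f y, hy, le_rfl⟩, fun ⟨_, hy⟩ => hy.1⟩

theorem finset_subset_of_subset_iUnion {A : ℕ → Set Y} (hA : Monotone A) {E : Finset Y}
    (hE : (E : Set Y) ⊆ ⋃ n, A n) : ∃ n, (E : Set Y) ⊆ A n :=
  hA.directed_le.exists_mem_subset_of_finset_subset_biUnion hE

theorem IsOmegaMonotone.comp {φ : Γ → CountableSubsets Y}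
    {ψ : CountableSubsets Y → CountableSubsets Z} (hψ : IsOmegaMonotone ψ)
    (hφ : IsOmegaMonotone φ) : IsOmegaMonotone (fun s => ψ (φ s)) where
  mono s t h := hψ.mono _ _ (hφ.mono s t h)
  sup s hs t ht := hψ.sup (fun n => φ (s n)) (fun _ _ h => hφ.mono _ _ (hs h)) _
    (isLUB_of_eq_iUnion (hφ.sup s hs t ht))

/-- The values of an `ω`-monotone map are determined by its values at finite sets. -/
theorem IsOmegaMonotone.exists_finset {φ : CountableSubsets Y → CountableSubsets Z}
    (hφ : IsOmegaMonotone φ) {A : CountableSubsets Y} {z : Z} (hz : z ∈ (φ A : Set Z)) :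
    ∃ E : Finset Y, (E : Set Y) ⊆ A ∧ z ∈ (φ (finsetToCountable E) : Set Z) := by
  obtain ⟨E, hE, hA⟩ := exists_monotone_finset_iUnion_eq A
  rw [hφ.sup (fun n => finsetToCountable (E n)) (fun _ _ h => Finset.coe_subset.2 (hE h)) A
    (isLUB_of_eq_iUnion hA)] at hz
  obtain ⟨n, hn⟩ := mem_iUnion.1 hz
  exact ⟨E n, hA ▸ subset_iUnion (fun n => (E n : Set Y)) n, hn⟩

/-- Every countable-valued map on finite sets is dominated by an `ω`-monotone map: take unions over
finite subsets. -/
theorem exists_isOmegaMonotone_of_finset (D : Finset Y → Set Z) (hD : ∀ E, (D E).Countable) :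
    ∃ φ : CountableSubsets Y → CountableSubsets Z, IsOmegaMonotone φ ∧
      ∀ A : CountableSubsets Y, ∀ E : Finset Y, (E : Set Y) ⊆ A → D E ⊆ φ A := by
  have hc (A : CountableSubsets Y) :
      (⋃ E ∈ {E : Finset Y | (E : Set Y) ⊆ A}, D E).Countable := by
    refine Countable.biUnion ?_ fun E _ => hD E
    refine ((countable_ofPred_finite_subset A.2).preimage Finset.coe_injective).mono ?_
    exact fun E hE => ⟨E.finite_toSet, hE⟩
  refine ⟨fun A => ⟨_, hc A⟩, ⟨fun A B h => ?_, fun s hs t ht => ?_⟩, fun A E hE => ?_⟩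
  · exact biUnion_subset_biUnion_left fun E hE => Subset.trans hE h
  · ext z
    simp only [mem_iUnion, mem_ofPred_eq, exists_prop]
    rw [eq_iUnion_of_isLUB ht]
    constructor
    · rintro ⟨E, hE, hz⟩
      obtain ⟨n, hn⟩ := finset_subset_of_subset_iUnion (fun _ _ h => hs h) hE
      exact ⟨n, E, hn, hz⟩
    · rintro ⟨n, E, hE, hz⟩
      exact ⟨E, hE.trans (subset_iUnion (fun n => (s n : Set Y)) n), hz⟩
  · exact subset_biUnion_of_mem (u := D) hE

/-- `A` is closed under the set-valued operation `c` on finite sets. -/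
def IsClosedUnder (c : Finset Y → Set Y) (A : CountableSubsets Y) : Prop :=
  ∀ E : Finset Y, (E : Set Y) ⊆ A → c E ⊆ A

theorem IsClosedUnder.iUnion {c : Finset Y → Set Y} {A : ℕ → CountableSubsets Y}
    (hA : Monotone A) (hc : ∀ n, IsClosedUnder c (A n)) {B : CountableSubsets Y}
    (hB : (B : Set Y) = ⋃ n, (A n : Set Y)) : IsClosedUnder c B := by
  intro E hE
  rw [hB] at hE ⊢
  obtain ⟨n, hn⟩ := finset_subset_of_subset_iUnion (fun _ _ h => hA h) hE
  exact (hc n E hn).trans (subset_iUnion (fun n => (A n : Set Y)) n)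

theorem exists_isClosedUnder (c : Finset Y → Set Y) (hc : ∀ E, (c E).Countable)
    (A : CountableSubsets Y) : ∃ B, A ≤ B ∧ IsClosedUnder c B := by
  obtain ⟨φ, -, hφ⟩ := exists_isOmegaMonotone_of_finset c hc
  let step : CountableSubsets Y → CountableSubsets Y := fun B =>
    ⟨(B : Set Y) ∪ (φ B : Set Y), B.2.union (φ B).2⟩
  let seq : ℕ → CountableSubsets Y := fun n => step^[n] A
  have hseq (n : ℕ) : (seq (n + 1) : Set Y) = (seq n : Set Y) ∪ (φ (seq n) : Set Y) := by
    simp only [seq, Function.iterate_succ_apply']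
    rfl
  have hmono : Monotone seq := monotone_nat_of_le_succ fun n => by
    change (seq n : Set Y) ⊆ seq (n + 1)
    rw [hseq]
    exact subset_union_left
  refine ⟨⟨⋃ n, (seq n : Set Y), countable_iUnion fun n => (seq n).2⟩,
    subset_iUnion (fun n => (seq n : Set Y)) 0, fun E hE => ?_⟩
  obtain ⟨n, hn⟩ := finset_subset_of_subset_iUnion (fun _ _ h => hmono h) hE
  refine Subset.trans ?_ (subset_iUnion (fun n => (seq n : Set Y)) (n + 1))
  rw [hseq]
  exact (hφ _ E hn).trans subset_union_right

/-- In an up-directed order, cofinally satisfied conditions indexed by finite sets can be satisfied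
monotonically. -/
theorem exists_monotone_of_cofinal [Nonempty Γ] (hdir : ∀ s t : Γ, ∃ u, s ≤ u ∧ t ≤ u)
    (P : Finset Y → Γ → Prop) (hP : ∀ E s, ∃ t, s ≤ t ∧ P E t) :
    ∃ s : Finset Y → Γ, Monotone s ∧ ∀ E, P E (s E) := by
  classical
  have : IsDirectedOrder Γ := ⟨hdir⟩
  have key (E : Finset Y) (g : ∀ E', E' ⊂ E → Γ) : ∃ t, P E t ∧ ∀ E' h, g E' h ≤ t := by
    let values : Finset Γ :=
      E.ssubsets.attach.image fun E' => g E'.1 (Finset.mem_ssubsets.1 E'.2)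
    obtain ⟨b, hb⟩ := values.exists_le
    obtain ⟨t, hbt, ht⟩ := hP E b
    refine ⟨t, ht, fun E' h => (hb _ ?_).trans hbt⟩
    exact Finset.mem_image.2 ⟨⟨E', Finset.mem_ssubsets.2 h⟩, Finset.mem_attach _ _, rfl⟩
  choose t ht hle using key
  have heq (E : Finset Y) : (Finset.strongInduction t E : Γ) =
      t E fun E' _ => Finset.strongInduction t E' := Finset.strongInduction_eq t E
  refine ⟨fun E => Finset.strongInduction t E, fun E E' h => ?_, fun E => ?_⟩
  · rcases h.eq_or_ssubset with rfl | h
    · exact le_rfl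
    · change _ ≤ Finset.strongInduction t E'
      rw [heq E']
      exact hle E' (fun E' _ => Finset.strongInduction t E') E h
  · change P E (Finset.strongInduction t E)
    rw [heq E]
    exact ht E _

end Countable

/-! ### From strong `r`-skeletons to monotone retractions -/

section Backward

variable {X : Type u} [TopologicalSpace X]

theorem IsCosmic.separableSpace {Y : Type u} [TopologicalSpace Y] (h : IsCosmic Y) :
    TopologicalSpace.SeparableSpace Y := by
  obtain ⟨𝒩, hc, h𝒩⟩ := h
  let 𝒩' : Set (Set Y) := {N ∈ 𝒩 | N.Nonempty}
  have hc' : 𝒩'.Countable := hc.mono fun N hN => hN.1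
  have : Countable 𝒩' := hc'
  choose p hp using fun N : 𝒩' => N.2.2
  refine ⟨range p, countable_range p, dense_iff_inter_open.2 ?_⟩
  rintro U hU ⟨y, hy⟩
  obtain ⟨N, hN, hyN, hNU⟩ := h𝒩 y U hU hy
  exact ⟨p ⟨N, hN, y, hyN⟩, hNU (hp ⟨N, hN, y, hyN⟩), mem_range_self _⟩

theorem IsCosmic.exists_countable_closure {A : Set X} (h : IsCosmic A) :
    ∃ D : Set X, D.Countable ∧ A ⊆ closure D := by
  have := h.separableSpace
  obtain ⟨D, hD, hdense⟩ := TopologicalSpace.exists_countable_dense A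
  refine ⟨(↑) '' D, hD.image _, fun x hx => ?_⟩
  exact image_closure_subset_closure_image continuous_subtype_val
    ⟨⟨x, hx⟩, hdense ⟨x, hx⟩, rfl⟩

/-- Finitely many nonempty closed sets are the sides of a closed box, and a power of a map that
preserves a nonempty box preserves its sides. -/
theorem IsStrongRSkeleton.exists_le_image_subset {Γ : Type v} [PartialOrder Γ] {r : Γ → X → X}
    (hr : IsStrongRSkeleton r) (E : Finset (NonemptyClosedSets X)) (s : Γ) :
    ∃ t, s ≤ t ∧ ∀ F ∈ E, r t '' (F : Set X) ⊆ F := by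
  let e := E.equivFin
  let B : Set (Fin E.card → X) := univ.pi fun i => ((e.symm i).1 : Set X)
  have hB : IsClosed B := isClosed_set_pi fun i _ => (e.symm i).1.2.2
  obtain ⟨t, hst, ht⟩ := hr.strong s _ B hB
  refine ⟨t, hst, ?_⟩
  rintro F hF _ ⟨x, hx, rfl⟩
  choose p hp using fun i => (e.symm i).1.2.1
  have hmem : Function.update p (e ⟨F, hF⟩) x ∈ B := by
    intro j _
    by_cases hj : j = e ⟨F, hF⟩
    · subst hj
      simpa using hx
    · simpa [hj] using hp j
  have := ht (mem_image_of_mem _ hmem) (e ⟨F, hF⟩) (mem_univ _)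
  simpa using this

theorem isMonotonicallySokolov_of_strong (hX : IsMonotonicallyOmegaMonolithic X)
    (hskel : HasStrongRSkeleton X) : IsMonotonicallySokolov X := by
  obtain ⟨𝒩, h𝒩, hnet⟩ := hX
  obtain ⟨Γ, _, r, hr⟩ := hskel
  have := hr.nonempty
  obtain ⟨s, hs, hsP⟩ := exists_monotone_of_cofinal hr.directed
    (fun (E : Finset (NonemptyClosedSets X)) t => ∀ F ∈ E, r t '' (F : Set X) ⊆ F)
    hr.exists_le_image_subset
  choose D hDc hD using fun E => (hr.cosmic (s E)).exists_countable_closure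
  obtain ⟨A, hA, hDA⟩ := exists_isOmegaMonotone_of_finset D hDc
  choose E hE hEeq using exists_monotone_finset_iUnion_eq (Y := NonemptyClosedSets X)
  choose t ht using fun ℱ => hr.sigmaComplete (fun n => s (E ℱ n)) (hs.comp (hE ℱ))
  have hlim (ℱ : CountableSubsets (NonemptyClosedSets X)) (x : X) :
      Tendsto (fun n => r (s (E ℱ n)) x) atTop (𝓝 (r (t ℱ) x)) :=
    hr.tendsto_sup _ (hs.comp (hE ℱ)) _ (ht ℱ) x
  refine ⟨fun ℱ => r (t ℱ), fun ℱ => 𝒩 (A ℱ), h𝒩.comp hA, fun ℱ =>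
    ⟨hr.retraction _, ?_, (hnet (A ℱ)).nonempty, (hnet (A ℱ)).isClosed, ?_⟩⟩
  · rintro F hF _ ⟨x, hx, rfl⟩
    rw [hEeq ℱ] at hF
    obtain ⟨m, hm⟩ := mem_iUnion.1 hF
    refine F.2.2.mem_of_tendsto (hlim ℱ x) ?_
    filter_upwards [eventually_ge_atTop m] with n hn
    exact hsP _ F (hE ℱ hn hm) (mem_image_of_mem _ hx)
  · rintro _ ⟨x, rfl⟩ U hU hxU
    refine (hnet (A ℱ)).exists_mem_subset _ ?_ U hU hxU
    refine isClosed_closure.mem_of_tendsto (hlim ℱ x) (Eventually.of_forall fun n => ?_)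
    refine closure_mono (hDA ℱ (E ℱ n) ?_) (hD _ (mem_range_self x))
    rw [hEeq ℱ]
    exact subset_iUnion (fun n => (E ℱ n : Set (NonemptyClosedSets X))) n

end Backward

/-! ### External networks and retractions -/

section Network

variable {X : Type u} [TopologicalSpace X]

theorem IsContinuousRetraction.eq_of_mem_range {r : X → X} (hr : IsContinuousRetraction r) {x : X}
    (hx : x ∈ range r) : r x = x := by
  obtain ⟨y, rfl⟩ := hx
  exact hr.idempotent y

theorem IsContinuousRetraction.isClosed_range [T2Space X] {r : X → X}
    (hr : IsContinuousRetraction r) : IsClosed (range r) := by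
  have : range r = {x | r x = x} :=
    Subset.antisymm (fun x hx => hr.eq_of_mem_range hx) fun x hx => ⟨x, hx⟩
  rw [this]
  exact isClosed_eq hr.continuous continuous_id

theorem IsExternalNetwork.eq_of_forall_mem [T1Space X] {𝒩 : Set (Set X)} {A : Set X}
    (h : IsExternalNetwork 𝒩 A) {x y : X} (hx : x ∈ A) (hxy : ∀ N ∈ 𝒩, x ∈ N → y ∈ N) :
    y = x := by
  by_contra hne
  obtain ⟨N, hN, hxN, hNU⟩ := h.exists_mem_subset x hx {y}ᶜ isOpen_compl_singleton
    fun h' => hne h'.symm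
  exact hNU (hxy N hN hxN) rfl

theorem IsExternalNetwork.isCosmic {𝒩 : Set (Set X)} {A : Set X} (hc : 𝒩.Countable)
    (h : IsExternalNetwork 𝒩 A) : IsCosmic A := by
  refine ⟨(fun N => (↑) ⁻¹' N) '' 𝒩, hc.image _, ?_⟩
  rintro y _ ⟨U, hU, rfl⟩ hy
  obtain ⟨N, hN, hyN, hNU⟩ := h.exists_mem_subset y y.2 U hU hy
  exact ⟨_, mem_image_of_mem _ hN, hyN, preimage_mono hNU⟩

theorem isMonotonicallyOmegaMonolithic_of_sokolov [T2Space X] (h : IsMonotonicallySokolov X) :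
    IsMonotonicallyOmegaMonolithic X := by
  obtain ⟨r, 𝒩, h𝒩, hr⟩ := h
  let sing : X → NonemptyClosedSets X := fun x => ⟨{x}, singleton_nonempty x, isClosed_singleton⟩
  let φ : CountableSubsets X → CountableSubsets (NonemptyClosedSets X) := fun A =>
    ⟨sing '' A, A.2.image _⟩
  have hφ : IsOmegaMonotone φ := by
    refine ⟨fun A B h => image_mono h, fun s _ t ht => ?_⟩
    change sing '' t = ⋃ n, sing '' (s n)
    rw [eq_iUnion_of_isLUB ht, image_iUnion]
  refine ⟨fun A => 𝒩 (φ A), h𝒩.comp hφ, fun A => ?_⟩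
  obtain ⟨hret, hpres, hnet⟩ := hr (φ A)
  refine ⟨hnet.nonempty, hnet.isClosed, fun x hx => hnet.exists_mem_subset x ?_⟩
  refine closure_minimal (fun a ha => ?_) hret.isClosed_range hx
  exact ⟨a, hpres (sing a) (mem_image_of_mem _ ha) (mem_image_of_mem _ (mem_singleton a))⟩

end Network

/-! ### The skeleton of saturated families -/

section Forward

variable {X : Type u} [TopologicalSpace X]

/-- The data witnessing that a space is monotonically Sokolov. -/
structure IsSokolovOperator (r : CountableSubsets (NonemptyClosedSets X) → X → X)
    (𝒩 : CountableSubsets (NonemptyClosedSets X) → CountableSubsets (Set X)) : Prop where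
  omegaMonotone : IsOmegaMonotone 𝒩
  retraction : ∀ ℱ, IsContinuousRetraction (r ℱ)
  map_mem : ∀ ℱ : CountableSubsets (NonemptyClosedSets X),
    ∀ F ∈ (ℱ : Set (NonemptyClosedSets X)), ∀ x ∈ (F : Set X), r ℱ x ∈ (F : Set X)
  network : ∀ ℱ, IsExternalNetwork (𝒩 ℱ : Set (Set X)) (range (r ℱ))

/-- The sets that a saturated family has to contain along with the finite set `E`: the members of
the network `𝒩 E` and their preimages under `r E`. Quantifying over the members of
`NonemptyClosedSets X` silently discards the empty preimages. -/
def saturationStep (r : CountableSubsets (NonemptyClosedSets X) → X → X)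
    (𝒩 : CountableSubsets (NonemptyClosedSets X) → CountableSubsets (Set X))
    (E : Finset (NonemptyClosedSets X)) : Set (NonemptyClosedSets X) :=
  {F | (F : Set X) ∈ (𝒩 (finsetToCountable E) : Set (Set X)) ∪
    (fun N => r (finsetToCountable E) ⁻¹' N) '' (𝒩 (finsetToCountable E) : Set (Set X))}

variable {r : CountableSubsets (NonemptyClosedSets X) → X → X}
  {𝒩 : CountableSubsets (NonemptyClosedSets X) → CountableSubsets (Set X)}
  {𝒢 𝒢' : CountableSubsets (NonemptyClosedSets X)}

theorem countable_saturationStep (E : Finset (NonemptyClosedSets X)) :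
    (saturationStep r 𝒩 E).Countable :=
  ((𝒩 (finsetToCountable E)).2.union ((𝒩 (finsetToCountable E)).2.image _)).preimage
    Subtype.val_injective

namespace IsSokolovOperator

theorem exists_mem_of_mem_network (h : IsSokolovOperator r 𝒩)
    (h𝒢 : IsClosedUnder (saturationStep r 𝒩) 𝒢) {N : Set X} (hN : N ∈ (𝒩 𝒢 : Set (Set X))) :
    ∃ F ∈ (𝒢 : Set (NonemptyClosedSets X)), (F : Set X) = N := by
  obtain ⟨E, hE, hNE⟩ := h.omegaMonotone.exists_finset hN
  exact ⟨⟨N, (h.network _).nonempty N hNE, (h.network _).isClosed N hNE⟩,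
    h𝒢 E hE (Or.inl hNE), rfl⟩

theorem map_mem_network (h : IsSokolovOperator r 𝒩)
    (h𝒢 : IsClosedUnder (saturationStep r 𝒩) 𝒢) (hle : 𝒢 ≤ 𝒢') {N : Set X}
    (hN : N ∈ (𝒩 𝒢 : Set (Set X))) {x : X} (hx : x ∈ N) : r 𝒢' x ∈ N := by
  obtain ⟨F, hF, rfl⟩ := h.exists_mem_of_mem_network h𝒢 hN
  exact h.map_mem 𝒢' F (hle hF) x hx

theorem apply_apply_of_le [T1Space X] (h : IsSokolovOperator r 𝒩)
    (h𝒢 : IsClosedUnder (saturationStep r 𝒩) 𝒢) (hle : 𝒢 ≤ 𝒢') (x : X) :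
    r 𝒢' (r 𝒢 x) = r 𝒢 x :=
  (h.network 𝒢).eq_of_forall_mem (mem_range_self x) fun _ hN hx =>
    h.map_mem_network h𝒢 hle hN hx

theorem finset_apply_apply [T1Space X] (h : IsSokolovOperator r 𝒩)
    (h𝒢 : IsClosedUnder (saturationStep r 𝒩) 𝒢) {E : Finset (NonemptyClosedSets X)}
    (hE : (E : Set (NonemptyClosedSets X)) ⊆ 𝒢) (x : X) :
    r (finsetToCountable E) (r 𝒢 x) = r (finsetToCountable E) x := by
  refine (h.network _).eq_of_forall_mem (mem_range_self x) fun N hN hx => ?_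
  let F : NonemptyClosedSets X := ⟨r (finsetToCountable E) ⁻¹' N, ⟨x, hx⟩,
    ((h.network _).isClosed N hN).preimage (h.retraction _).continuous⟩
  exact h.map_mem 𝒢 F (h𝒢 E hE (Or.inr ⟨N, hN, rfl⟩)) x hx

/-- The retractions `r E` with `E ⊆ 𝒢` finite separate the points of `range (r 𝒢)`: disjoint members
of `𝒩 𝒢` around two points are preserved by `r E` as soon as they belong to `E`. -/
theorem eq_of_forall_finset [T2Space X] (h : IsSokolovOperator r 𝒩)
    (h𝒢 : IsClosedUnder (saturationStep r 𝒩) 𝒢) {x y : X} (hx : x ∈ range (r 𝒢))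
    (hy : y ∈ range (r 𝒢)) (hxy : ∀ E : Finset (NonemptyClosedSets X),
      (E : Set (NonemptyClosedSets X)) ⊆ 𝒢 →
        r (finsetToCountable E) x = r (finsetToCountable E) y) : x = y := by
  classical
  by_contra hne
  obtain ⟨U, V, hU, hV, hxU, hyV, hUV⟩ := t2_separation hne
  obtain ⟨N, hN, hxN, hNU⟩ := (h.network 𝒢).exists_mem_subset x hx U hU hxU
  obtain ⟨M, hM, hyM, hMV⟩ := (h.network 𝒢).exists_mem_subset y hy V hV hyV
  obtain ⟨F, hF, rfl⟩ := h.exists_mem_of_mem_network h𝒢 hN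
  obtain ⟨G, hG, rfl⟩ := h.exists_mem_of_mem_network h𝒢 hM
  have h1 := h.map_mem (finsetToCountable {F, G}) F (by simp [finsetToCountable]) x hxN
  have h2 := h.map_mem (finsetToCountable {F, G}) G (by simp [finsetToCountable]) y hyM
  rw [hxy {F, G} (by simp [insert_subset_iff, hF, hG])] at h1
  exact disjoint_left.1 hUV (hNU h1) (hMV h2)

theorem apply_apply_of_ge [T2Space X] (h : IsSokolovOperator r 𝒩)
    (h𝒢 : IsClosedUnder (saturationStep r 𝒩) 𝒢) (h𝒢' : IsClosedUnder (saturationStep r 𝒩) 𝒢')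
    (hle : 𝒢 ≤ 𝒢') (x : X) : r 𝒢 (r 𝒢' x) = r 𝒢 x := by
  refine h.eq_of_forall_finset h𝒢 (mem_range_self _) (mem_range_self _) fun E hE => ?_
  rw [h.finset_apply_apply h𝒢 hE, h.finset_apply_apply h𝒢 hE,
    h.finset_apply_apply h𝒢' (hE.trans hle)]

theorem tendsto_of_eq_iUnion [T2Space X] (h : IsSokolovOperator r 𝒩)
    {𝒮 : ℕ → CountableSubsets (NonemptyClosedSets X)} (hmono : Monotone 𝒮)
    (h𝒮 : ∀ n, IsClosedUnder (saturationStep r 𝒩) (𝒮 n))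
    (h𝒢 : IsClosedUnder (saturationStep r 𝒩) 𝒢)
    (hlub : (𝒢 : Set (NonemptyClosedSets X)) = ⋃ n, (𝒮 n : Set (NonemptyClosedSets X))) (x : X) :
    Tendsto (fun n => r (𝒮 n) x) atTop (𝓝 (r 𝒢 x)) := by
  have hle (n : ℕ) : 𝒮 n ≤ 𝒢 := (isLUB_of_eq_iUnion hlub).1 (mem_range_self n)
  refine tendsto_nhds.2 fun U hU hxU => ?_
  obtain ⟨N, hN, hxN, hNU⟩ := (h.network 𝒢).exists_mem_subset _ (mem_range_self x) U hU hxU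
  obtain ⟨F, hF, rfl⟩ := h.exists_mem_of_mem_network h𝒢 hN
  rw [hlub] at hF
  obtain ⟨m, hm⟩ := mem_iUnion.1 hF
  filter_upwards [eventually_ge_atTop m] with n hn
  change r (𝒮 n) x ∈ U
  rw [← h.apply_apply_of_ge (h𝒮 n) h𝒢 (hle n)]
  exact hNU (h.map_mem _ F (hmono hn hm) _ hxN)

/-- Saturated families whose retraction preserves a given closed subset `H` of a power are cofinal:
it is enough to add, for tuples of members contained in an open box that misses `H`, the complements
of the sides of such a box. -/
theorem exists_saturated_image_subset (h : IsSokolovOperator r 𝒩)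
    (𝒢 : CountableSubsets (NonemptyClosedSets X)) {n : ℕ} {H : Set (Fin n → X)}
    (hH : IsClosed H) :
    ∃ 𝒢', 𝒢 ≤ 𝒢' ∧ IsClosedUnder (saturationStep r 𝒩) 𝒢' ∧
      (fun (x : Fin n → X) (i : Fin n) => r 𝒢' (x i)) '' H ⊆ H := by
  classical
  let Q (F : Fin n → NonemptyClosedSets X) (U : Fin n → Set X) : Prop :=
    (∀ i, IsOpen (U i) ∧ (F i : Set X) ⊆ U i) ∧ Disjoint (univ.pi U) H
  have hQ (F : Fin n → NonemptyClosedSets X) : ∃ U, (∃ V, Q F V) → Q F U := by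
    by_cases hV : ∃ V, Q F V
    · exact ⟨hV.choose, fun _ => hV.choose_spec⟩
    · exact ⟨fun _ => univ, fun h => absurd h hV⟩
  choose U hU using hQ
  let box (E : Finset (NonemptyClosedSets X)) : Set (NonemptyClosedSets X) :=
    {G | (G : Set X) ∈ range fun p : (Fin n → E) × Fin n => (U (fun i => (p.1 i).1) p.2)ᶜ}
  obtain ⟨𝒢', hle, hcl⟩ := exists_isClosedUnder (fun E => saturationStep r 𝒩 E ∪ box E)
    (fun E => (countable_saturationStep E).union
      ((countable_range _).preimage Subtype.val_injective)) 𝒢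
  have hsat : IsClosedUnder (saturationStep r 𝒩) 𝒢' := fun E hE =>
    subset_union_left.trans (hcl E hE)
  refine ⟨𝒢', hle, hsat, ?_⟩
  rintro _ ⟨x, hx, rfl⟩
  by_contra hnot
  obtain ⟨V, hV, hVH⟩ := isOpen_pi_iff'.1 hH.isOpen_compl _ hnot
  choose N hN hxN hNV using fun i =>
    (h.network 𝒢').exists_mem_subset _ (mem_range_self (x i)) (V i) (hV i).1 (hV i).2
  choose F hF hFN using fun i => h.exists_mem_of_mem_network hsat (hN i)
  obtain ⟨hUF, hUH⟩ := hU F ⟨V, fun i => ⟨(hV i).1, hFN i ▸ hNV i⟩,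
    disjoint_left.2 fun y hy => hVH hy⟩
  refine disjoint_left.1 hUH (fun i _ => ?_) hx
  by_contra hxi
  let G : NonemptyClosedSets X := ⟨(U F i)ᶜ, ⟨x i, hxi⟩, (hUF i).1.isClosed_compl⟩
  have hG : G ∈ (𝒢' : Set (NonemptyClosedSets X)) := by
    refine hcl (Finset.univ.image F) ?_ (Or.inr ?_)
    · simpa [range_subset_iff] using hF
    · exact ⟨(fun j => ⟨F j, Finset.mem_image_of_mem F (Finset.mem_univ j)⟩, i), rfl⟩
  exact h.map_mem 𝒢' G hG (x i) hxi ((hUF i).2 ((hFN i).symm ▸ hxN i))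

theorem isStrongRSkeleton [T3Space X] (h : IsSokolovOperator r 𝒩) :
    IsStrongRSkeleton (fun 𝒢 : {𝒢 // IsClosedUnder (saturationStep r 𝒩) 𝒢} => r 𝒢.1) := by
  have hcof := exists_isClosedUnder (saturationStep r 𝒩) countable_saturationStep
  have hlub (s : ℕ → {𝒢 // IsClosedUnder (saturationStep r 𝒩) 𝒢}) (hs : Monotone s) :
      ∃ t : {𝒢 // IsClosedUnder (saturationStep r 𝒩) 𝒢}, IsLUB (range s) t ∧
        (t.1 : Set (NonemptyClosedSets X)) = ⋃ n, ((s n).1 : Set (NonemptyClosedSets X)) := by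
    let B : CountableSubsets (NonemptyClosedSets X) :=
      ⟨⋃ n, ((s n).1 : Set (NonemptyClosedSets X)), countable_iUnion fun n => (s n).1.2⟩
    have hB : IsLUB (range fun n => (s n).1) B := isLUB_of_eq_iUnion rfl
    refine ⟨⟨B, IsClosedUnder.iUnion (fun _ _ h => hs h) (fun n => (s n).2) rfl⟩, ⟨?_, ?_⟩, rfl⟩
    · rintro _ ⟨n, rfl⟩
      exact hB.1 (mem_range_self n)
    · intro C hC
      refine hB.2 ?_
      rintro _ ⟨n, rfl⟩
      exact hC (mem_range_self n)
  refine
    { nonempty := ?_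
      directed := ?_
      sigmaComplete := fun s hs => (hlub s hs).imp fun t ht => ht.1
      retraction := fun s => h.retraction _
      cosmic := fun s => (h.network s.1).isCosmic (𝒩 s.1).2
      comp_left := fun s t hst => funext fun x => (h.apply_apply_of_ge s.2 t.2 hst x).symm
      comp_right := fun s t hst => funext fun x => (h.apply_apply_of_le s.2 hst x).symm
      tendsto_sup := ?_
      tendsto_id := ?_
      strong := ?_ }
  · obtain ⟨B, -, hB⟩ := hcof ⟨∅, countable_empty⟩
    exact ⟨⟨B, hB⟩⟩
  · intro s t
    obtain ⟨B, hle, hB⟩ := hcof ⟨s.1 ∪ t.1, s.1.2.union t.1.2⟩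
    exact ⟨⟨B, hB⟩, subset_union_left.trans hle, subset_union_right.trans hle⟩
  · intro s hs t ht x
    obtain ⟨t', ht', heq⟩ := hlub s hs
    obtain rfl := ht.unique ht'
    exact h.tendsto_of_eq_iUnion (fun _ _ h => hs h) (fun n => (s n).2) t.2 heq x
  · intro x
    refine tendsto_nhds.2 fun U hU hxU => ?_
    obtain ⟨K, hK, hKc, hKU⟩ := exists_mem_nhds_isClosed_subset (hU.mem_nhds hxU)
    let F : NonemptyClosedSets X := ⟨K, ⟨x, mem_of_mem_nhds hK⟩, hKc⟩
    obtain ⟨B, hle, hB⟩ := hcof ⟨{F}, countable_singleton F⟩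
    filter_upwards [eventually_ge_atTop (⟨B, hB⟩ : {𝒢 // IsClosedUnder (saturationStep r 𝒩) 𝒢})]
      with s hs
    exact hKU (h.map_mem s.1 F (hs (hle (mem_singleton F))) x (mem_of_mem_nhds hK))
  · intro s n H hH
    obtain ⟨𝒢', hle, hsat, himg⟩ := h.exists_saturated_image_subset s.1 hH
    exact ⟨⟨𝒢', hsat⟩, hle, himg⟩

end IsSokolovOperator

theorem hasStrongRSkeleton_of_sokolov [T3Space X] (h : IsMonotonicallySokolov X) :
    HasStrongRSkeleton X := by
  obtain ⟨r, 𝒩, h𝒩, hr⟩ := h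
  have hop : IsSokolovOperator r 𝒩 :=
    ⟨h𝒩, fun ℱ => (hr ℱ).1, fun ℱ F hF _ hx => (hr ℱ).2.1 F hF (mem_image_of_mem _ hx),
      fun ℱ => (hr ℱ).2.2⟩
  exact ⟨_, inferInstance, _, hop.isStrongRSkeleton⟩

end Forward

end MonotoneTopology

theorem corollary5p9 (X : Type u) [TopologicalSpace X] [T35Space X] :
    MonotoneTopology.IsMonotonicallySokolov X ↔
      MonotoneTopology.IsMonotonicallyOmegaMonolithic X ∧
        MonotoneTopology.HasStrongRSkeleton X :=
  ⟨fun h => ⟨MonotoneTopology.isMonotonicallyOmegaMonolithic_of_sokolov h,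
    MonotoneTopology.hasStrongRSkeleton_of_sokolov h⟩,
    fun h => MonotoneTopology.isMonotonicallySokolov_of_strong h.1 h.2⟩
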